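/- Throughout, fix a universe; "small" refers to it. A Reedy category is a small category $A$ with two wide subcategories $A^{\to}$ (direct) and $A^{\leftarrow}$ (inverse) such that, for some function $\deg\colon \mathrm{Ob}\,A\to\lambda$ to an ordinal, every nonidentity morphism of $A^{\to}$ strictly raises the degree, every nonidentity morphism of $A^{\leftarrow}$ strictly lowers it, and every morphism of $A$ factors uniquely as a morphism of $A^{\leftarrow}$ followed by a morphism of $A^{\to}$. A morphism $f\colon A\to B$ of Reedy categories is a functor with $f(A^{\to})\subseteq B^{\to}$ and $f(A^{\leftarrow})\subseteq B^{\leftarrow}$. It is a left fibration (resp. right fibration) if for every locally small model category $M$ with all small limits and colimits, the adjunction $f_!\colon M^A\rightleftarrows M^B\colon f^{\star}$ (resp. $f^{\star}\colon M^B\rightleftarrows M^A\colon f_{\star}$), where $f^{\star}$ is precomposition with $f$, is a Quillen adjunction for the Reedy model structures; that is, $f^{\star}$ preserves Reedy fibrations and trivial Reedy fibrations (resp. Reedy cofibrations and trivial Reedy cofibrations). A Reedy category $A$ is left (resp. right) fibrant if the functor from $A$ to the terminal category is a left (resp. right) fibration. Let $A$ be a Reedy category, let $C$ be a locally small category with all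 finite products (resp. all finite coproducts), and let $A\to C$ be a fully faithful functor. For an object $\gamma$ of $C$, the slice category $(A/\gamma)$ (resp. $(\gamma/A)$) is a Reedy category whose direct and inverse morphisms are those that the forgetful functor to $A$ sends to $A^{\to}$ and to $A^{\leftarrow}$, respectively. Suppose that for every object $\gamma$ of $C$ the Reedy category $(A/\gamma)$ (resp. $(\gamma/A)$) is left (resp. right) fibrant. Then for every morphism $\gamma\to\gamma'$ of $C$, the forgetful functor $(A/\gamma)\to(A/\gamma')$ (resp. $(\gamma'/A)\to(\gamma/A)$) is a left (resp. right) fibration. -/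

import Mathlib

open CategoryTheory CategoryTheory.Limits HomotopicalAlgebra

universe u u' w

/-- A small Reedy category: a small category `A` with two wide subcategories, the inverse one
(morphisms lowering the degree) and the direct one (morphisms raising the degree), such that for
some degree function with values in a well-ordered type every nonidentity morphism of the inverse
(resp. direct) subcategory strictly lowers (resp. raises) the degree, and every morphism factors
uniquely as an inverse morphism followed by a direct one. -/
class ReedyCategory (A : Type w) [SmallCategory A] where
  /-- the morphisms of the inverse subcategory -/
  inverse : MorphismProperty A
  /-- the morphisms of the direct subcategory -/
  direct : MorphismProperty A
  isMultiplicative_inverse : inverse.IsMultiplicative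
  isMultiplicative_direct : direct.IsMultiplicative
  exists_reedyStructure :
    ∃ (α : Type w) (_ : LinearOrder α) (_ : OrderBot α) (_ : SuccOrder α) (_ : WellFoundedLT α),
      Nonempty (ReedyStructure inverse direct α)

namespace ReedyCategory

attribute [instance] isMultiplicative_inverse isMultiplicative_direct

/-- A functor that reflects identities, lifts factorizations uniquely and reflects their
membership yields a Reedy structure on its source. -/
lemma exists_reedyStructure_inverseImage {A B : Type w} [SmallCategory A] [ReedyCategory A]
    [SmallCategory B] (P : B ⥤ A)
    (hid : ∀ ⦃x y : B⦄ (f : x ⟶ y), MorphismProperty.identities A (P.map f) →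
      MorphismProperty.identities B f)
    (hlift : ∀ ⦃x y : B⦄ (f : x ⟶ y) (z : A) (i : P.obj x ⟶ z) (p : z ⟶ P.obj y),
      i ≫ p = P.map f → ∃ (z' : B) (i' : x ⟶ z') (p' : z' ⟶ y) (e : P.obj z' = z),
        i' ≫ p' = f ∧ P.map i' = i ≫ eqToHom e.symm ∧ P.map p' = eqToHom e ≫ p)
    (huniq : ∀ ⦃x y z z' : B⦄ (i : x ⟶ z) (p : z ⟶ y) (i' : x ⟶ z') (p' : z' ⟶ y),
      i ≫ p = i' ≫ p' → ∀ (e : P.obj z = P.obj z'), P.map i ≫ eqToHom e = P.map i' →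
        P.map p = eqToHom e ≫ P.map p' →
        ∃ e' : z = z', i ≫ eqToHom e' = i' ∧ p = eqToHom e' ≫ p') :
    ∃ (α : Type w) (_ : LinearOrder α) (_ : OrderBot α) (_ : SuccOrder α) (_ : WellFoundedLT α),
      Nonempty (ReedyStructure ((inverse (A := A)).inverseImage P)
        ((direct (A := A)).inverseImage P) α) := by
  obtain ⟨α, i₁, i₂, i₃, i₄, ⟨r⟩⟩ := exists_reedyStructure (A := A)
  refine ⟨α, i₁, i₂, i₃, i₄, ⟨{
    deg := fun x ↦ r.deg (P.obj x)
    lt₁ := fun f hf hf' ↦ r.lt₁ (P.map f) hf (fun h ↦ hf' (hid f h))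
    lt₂ := fun f hf hf' ↦ r.lt₂ (P.map f) hf (fun h ↦ hf' (hid f h))
    nonempty_unique := ?_ }⟩⟩
  intro x y f
  obtain ⟨Z, a, b, ha, hb, hab, -⟩ := r.exists_fac (P.map f)
  obtain ⟨z, i, p, e, hip, hi, hp⟩ := hlift f Z a b hab
  subst e
  simp only [eqToHom_refl, Category.comp_id, Category.id_comp] at hi hp
  refine ⟨⟨⟨⟨z, i, p, hip, ?_, ?_⟩⟩, ?_⟩⟩
  · simpa [MorphismProperty.inverseImage_iff, hi] using ha
  · simpa [MorphismProperty.inverseImage_iff, hp] using hb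
  · rintro ⟨z', i', p', hip', hi', hp'⟩
    obtain ⟨e, h₁, h₂⟩ := r.unique (f := P.map f)
      ⟨P.obj z', P.map i', P.map p', by rw [← P.map_comp, hip'], hi', hp'⟩
      ⟨P.obj z, a, b, hab, ha, hb⟩
    obtain ⟨e', h₃, h₄⟩ := huniq i' p' i p (hip'.trans hip.symm) e
      (by simpa [hi] using congrArg (· ≫ eqToHom e) h₁) (by simpa [hp] using h₂)
    subst e'
    simp only [eqToHom_refl, Category.comp_id, Category.id_comp] at h₃ h₄
    subst h₃ h₄
    rfl

variable {A : Type w} [SmallCategory A] [ReedyCategory A] {C : Type u} [Category.{w} C]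

/-- The slice category `(A/γ)`, its inverse and direct morphisms being those that the forgetful
functor to `A` sends to inverse and direct morphisms. -/
instance costructuredArrow (F : A ⥤ C) (γ : C) : ReedyCategory (CostructuredArrow F γ) where
  inverse := inverse.inverseImage (CostructuredArrow.proj F γ)
  direct := direct.inverseImage (CostructuredArrow.proj F γ)
  isMultiplicative_inverse := inferInstance
  isMultiplicative_direct := inferInstance
  exists_reedyStructure := by
    apply exists_reedyStructure_inverseImage
    · have key : ∀ {a b : A} (k : a ⟶ b), MorphismProperty.identities A k →
          ∃ h : a = b, k = eqToHom h := by
        rintro _ _ _ ⟨a⟩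
        exact ⟨rfl, rfl⟩
      intro ⟨a, ⟨⟨⟩⟩, k⟩ ⟨b, ⟨⟨⟩⟩, l⟩ f hf
      obtain ⟨e, he⟩ := key _ hf
      change a = b at e
      change f.left = eqToHom e at he
      have hw := CostructuredArrow.w f
      subst e
      rw [he] at hw
      replace hw : l = k := by
        simpa using hw
      subst hw
      have : f = 𝟙 _ := CostructuredArrow.hom_ext _ _ he
      rw [this]
      constructor
    · intro x y f z (i : x.left ⟶ z) (p : z ⟶ y.left) (hip : i ≫ p = f.left)
      exact ⟨CostructuredArrow.mk (F.map p ≫ y.hom),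
        CostructuredArrow.homMk i (by
          have := CostructuredArrow.w f
          rw [← hip, F.map_comp, Category.assoc] at this
          exact this),
        CostructuredArrow.homMk p rfl, rfl,
        CostructuredArrow.hom_ext _ _ hip, (Category.comp_id i).symm, (Category.id_comp p).symm⟩
    · intro x y ⟨a, ⟨⟨⟩⟩, k⟩ ⟨b, ⟨⟨⟩⟩, l⟩ i p i' p' h (e : a = b)
        (h₁ : i.left ≫ eqToHom e = i'.left) (h₂ : p.left = eqToHom e ≫ p'.left)
      subst e
      simp only [eqToHom_refl, Category.comp_id, Category.id_comp] at h₁ h₂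
      have hw := CostructuredArrow.w p
      have hw' := CostructuredArrow.w p'
      rw [h₂] at hw
      obtain rfl : k = l := hw.symm.trans hw'
      exact ⟨rfl, by simpa using CostructuredArrow.hom_ext _ _ h₁,
        by simpa using CostructuredArrow.hom_ext _ _ h₂⟩

/-- The slice category `(γ/A)`, its inverse and direct morphisms being those that the forgetful
functor to `A` sends to inverse and direct morphisms. -/
instance structuredArrow (F : A ⥤ C) (γ : C) : ReedyCategory (StructuredArrow γ F) where
  inverse := inverse.inverseImage (StructuredArrow.proj γ F)
  direct := direct.inverseImage (StructuredArrow.proj γ F)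
  isMultiplicative_inverse := inferInstance
  isMultiplicative_direct := inferInstance
  exists_reedyStructure := by
    apply exists_reedyStructure_inverseImage
    · have key : ∀ {a b : A} (k : a ⟶ b), MorphismProperty.identities A k →
          ∃ h : a = b, k = eqToHom h := by
        rintro _ _ _ ⟨a⟩
        exact ⟨rfl, rfl⟩
      intro ⟨⟨⟨⟩⟩, a, k⟩ ⟨⟨⟨⟩⟩, b, l⟩ f hf
      obtain ⟨e, he⟩ := key _ hf
      change a = b at e
      change f.right = eqToHom e at he
      have hw := StructuredArrow.w f
      subst e
      rw [he] at hw
      replace hw : k = l := by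
        simpa using hw
      subst hw
      have : f = 𝟙 _ := StructuredArrow.hom_ext _ _ he
      rw [this]
      constructor
    · intro x y f z (i : x.right ⟶ z) (p : z ⟶ y.right) (hip : i ≫ p = f.right)
      exact ⟨StructuredArrow.mk (x.hom ≫ F.map i),
        StructuredArrow.homMk i rfl,
        StructuredArrow.homMk p (by
          have := StructuredArrow.w f
          rw [← hip, F.map_comp, ← Category.assoc] at this
          exact this), rfl,
        StructuredArrow.hom_ext _ _ hip, (Category.comp_id i).symm, (Category.id_comp p).symm⟩
    · intro x y ⟨⟨⟨⟩⟩, a, k⟩ ⟨⟨⟨⟩⟩, b, l⟩ i p i' p' h (e : a = b)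
        (h₁ : i.right ≫ eqToHom e = i'.right) (h₂ : p.right = eqToHom e ≫ p'.right)
      subst e
      simp only [eqToHom_refl, Category.comp_id, Category.id_comp] at h₁ h₂
      have hw := StructuredArrow.w i
      have hw' := StructuredArrow.w i'
      rw [h₁] at hw
      obtain rfl : k = l := hw.symm.trans hw'
      exact ⟨rfl, by simpa using StructuredArrow.hom_ext _ _ h₁,
        by simpa using StructuredArrow.hom_ext _ _ h₂⟩

/-- The terminal category. -/
instance terminal : ReedyCategory (Discrete PUnit.{w + 1}) where
  inverse := ⊤
  direct := ⊤
  isMultiplicative_inverse := inferInstance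
  isMultiplicative_direct := inferInstance
  exists_reedyStructure := by
    have hid : ∀ {X Y : Discrete PUnit.{w + 1}} (f : X ⟶ Y),
        MorphismProperty.identities (Discrete PUnit.{w + 1}) f := by
      rintro ⟨⟨⟩⟩ ⟨⟨⟩⟩ f
      obtain rfl : f = 𝟙 _ := Subsingleton.elim _ _
      constructor
    let _ : SuccOrder PUnit.{w + 1} := SuccOrder.ofLinearWellFoundedLT _
    refine ⟨PUnit, inferInstance, inferInstance, inferInstance, inferInstance, ⟨{
        deg := fun _ ↦ ⟨⟩
        lt₁ := fun f _ hf ↦ (hf (hid f)).elim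
        lt₂ := fun f _ hf ↦ (hf (hid f)).elim
        nonempty_unique := fun {X Y} f ↦ ⟨⟨⟨⟨X, 𝟙 X, f, by simp, trivial, trivial⟩⟩, ?_⟩⟩ }⟩⟩
    rintro ⟨⟨⟨⟩⟩, i, p, h, h₁, h₂⟩
    obtain ⟨⟨⟩⟩ := X
    obtain rfl : i = 𝟙 _ := Subsingleton.elim _ _
    obtain rfl : p = f := Subsingleton.elim _ _
    rfl

end ReedyCategory

namespace Reedy

section Diagrams

variable {A : Type w} [SmallCategory A] [ReedyCategory A]

/-- The latching category `∂(A^→/a)` at `a`: its objects are the nonidentity direct morphisms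
`b ⟶ a`, its morphisms are the direct morphisms over `a`. -/
abbrev LatchingCategory (a : A) : Type w :=
  (ReedyCategory.direct ⊓ (MorphismProperty.identities A)ᶜ).Over ReedyCategory.direct a

/-- The matching category `∂(a/A^←)` at `a`: its objects are the nonidentity inverse morphisms
`a ⟶ b`, its morphisms are the inverse morphisms under `a`. -/
abbrev MatchingCategory (a : A) : Type w :=
  (ReedyCategory.inverse ⊓ (MorphismProperty.identities A)ᶜ).Under ReedyCategory.inverse a

/-- The forgetful functor from the latching category. -/
abbrev latchingForget (a : A) : LatchingCategory a ⥤ A :=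
  MorphismProperty.Over.forget _ _ a ⋙ CategoryTheory.Over.forget a

/-- The forgetful functor from the matching category. -/
abbrev matchingForget (a : A) : MatchingCategory a ⥤ A :=
  MorphismProperty.Under.forget _ _ a ⋙ CategoryTheory.Under.forget a

variable {M : Type u'} [Category.{w} M]

section Latching

variable [HasColimitsOfSize.{w, w} M]

/-- The latching object `L_a X`. -/
noncomputable abbrev latchingObj (X : A ⥤ M) (a : A) : M :=
  colimit (latchingForget a ⋙ X)

/-- The cocone on the latching diagram given by the structure morphisms `X_b ⟶ X_a`. -/
@[simps]
def latchingCocone (X : A ⥤ M) (a : A) : Cocone (latchingForget a ⋙ X) where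
  pt := X.obj a
  ι :=
    { app := fun b ↦ X.map b.hom
      naturality := fun b c g ↦ by
        have h : X.map g.left ≫ X.map c.hom = X.map b.hom := by
          rw [← X.map_comp, MorphismProperty.Over.w g]
        exact h.trans (Category.comp_id _).symm }

/-- The canonical morphism `L_a X ⟶ X_a`. -/
noncomputable abbrev latchingMap (X : A ⥤ M) (a : A) : latchingObj X a ⟶ X.obj a :=
  colimit.desc (latchingForget a ⋙ X) (latchingCocone X a)

/-- The morphism `L_a X ⟶ L_a Y` induced by `φ : X ⟶ Y`. -/
noncomputable abbrev latchingObjMap {X Y : A ⥤ M} (φ : X ⟶ Y) (a : A) :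
    latchingObj X a ⟶ latchingObj Y a :=
  colimMap (Functor.whiskerLeft (latchingForget a) φ)

/-- The relative latching map `X_a ⨿_{L_a X} L_a Y ⟶ Y_a` of `φ : X ⟶ Y`. -/
noncomputable def relativeLatchingMap [HasPushouts M] {X Y : A ⥤ M} (φ : X ⟶ Y) (a : A) :
    pushout (latchingMap X a) (latchingObjMap φ a) ⟶ Y.obj a :=
  pushout.desc (φ.app a) (latchingMap Y a) (by
    apply colimit.hom_ext
    intro b
    have h₁ := colimit.ι_desc (latchingCocone X a) b
    have h₂ := colimit.ι_desc (latchingCocone Y a) b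
    have h₃ := ι_colimMap (Functor.whiskerLeft (latchingForget a) φ) b
    rw [← Category.assoc, ← Category.assoc]
    refine (congrArg (· ≫ φ.app a) h₁).trans (Eq.trans ?_
      (congrArg (· ≫ latchingMap Y a) h₃).symm)
    refine (φ.naturality b.hom).trans (Eq.trans ?_ (Category.assoc _ _ _).symm)
    exact congrArg (φ.app _ ≫ ·) h₂.symm)

end Latching

section Matching

variable [HasLimitsOfSize.{w, w} M]

/-- The matching object `M^a X`. -/
noncomputable abbrev matchingObj (X : A ⥤ M) (a : A) : M :=
  limit (matchingForget a ⋙ X)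

/-- The cone on the matching diagram given by the structure morphisms `X_a ⟶ X_b`. -/
@[simps]
def matchingCone (X : A ⥤ M) (a : A) : Cone (matchingForget a ⋙ X) where
  pt := X.obj a
  π :=
    { app := fun b ↦ X.map b.hom
      naturality := fun b c g ↦ by
        have h : X.map b.hom ≫ X.map g.right = X.map c.hom := by
          rw [← X.map_comp, MorphismProperty.Under.w g]
        exact (Category.id_comp _).trans h.symm }

/-- The canonical morphism `X_a ⟶ M^a X`. -/
noncomputable abbrev matchingMap (X : A ⥤ M) (a : A) : X.obj a ⟶ matchingObj X a :=
  limit.lift (matchingForget a ⋙ X) (matchingCone X a)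

/-- The morphism `M^a X ⟶ M^a Y` induced by `φ : X ⟶ Y`. -/
noncomputable abbrev matchingObjMap {X Y : A ⥤ M} (φ : X ⟶ Y) (a : A) :
    matchingObj X a ⟶ matchingObj Y a :=
  limMap (Functor.whiskerLeft (matchingForget a) φ)

/-- The relative matching map `X_a ⟶ M^a X ×_{M^a Y} Y_a` of `φ : X ⟶ Y`. -/
noncomputable def relativeMatchingMap [HasPullbacks M] {X Y : A ⥤ M} (φ : X ⟶ Y) (a : A) :
    X.obj a ⟶ pullback (matchingObjMap φ a) (matchingMap Y a) :=
  pullback.lift (matchingMap X a) (φ.app a) (by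
    apply limit.hom_ext
    intro b
    have h₁ := limit.lift_π (matchingCone X a) b
    have h₂ := limit.lift_π (matchingCone Y a) b
    have h₃ := limMap_π (Functor.whiskerLeft (matchingForget a) φ) b
    rw [Category.assoc, Category.assoc]
    refine (congrArg (matchingMap X a ≫ ·) h₃).trans (Eq.trans ?_
      (congrArg (φ.app a ≫ ·) h₂).symm)
    refine (Category.assoc _ _ _).symm.trans (Eq.trans ?_ (φ.naturality b.hom))
    exact congrArg (· ≫ φ.app _) h₁)

end Matching

end Diagrams

section ModelStructure

variable (A : Type w) [SmallCategory A]
  (M : Type u') [Category.{w} M] [ModelCategory M]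

/-- The weak equivalences of the Reedy model structure on `A ⥤ M`. -/
def weakEquivalences : MorphismProperty (A ⥤ M) :=
  (HomotopicalAlgebra.weakEquivalences M).functorCategory A

variable [ReedyCategory A]

/-- The cofibrations of the Reedy model structure on `A ⥤ M`. -/
def cofibrations [HasColimitsOfSize.{w, w} M] : MorphismProperty (A ⥤ M) :=
  fun _ _ φ ↦ ∀ a : A, HomotopicalAlgebra.cofibrations M (relativeLatchingMap φ a)

/-- The fibrations of the Reedy model structure on `A ⥤ M`. -/
def fibrations [HasLimitsOfSize.{w, w} M] : MorphismProperty (A ⥤ M) :=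
  fun _ _ φ ↦ ∀ a : A, HomotopicalAlgebra.fibrations M (relativeMatchingMap φ a)

end ModelStructure

end Reedy

/-- `G : D ⥤ E` is a right Quillen functor for the given classes of fibrations and weak
equivalences (those of model structures on `D` and `E`): it has a left adjoint, and it preserves
fibrations and trivial fibrations. Equivalently, the adjunction between `G` and its left adjoint is
a Quillen adjunction. -/
structure IsRightQuillen {D E : Type*} [Category* D] [Category* E] (G : D ⥤ E)
    (fibD weqD : MorphismProperty D) (fibE weqE : MorphismProperty E) : Prop where
  isRightAdjoint : G.IsRightAdjoint
  map_fibration : ∀ ⦃X Y : D⦄ (p : X ⟶ Y), fibD p → fibE (G.map p)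
  map_trivialFibration : ∀ ⦃X Y : D⦄ (p : X ⟶ Y), fibD p → weqD p →
    fibE (G.map p) ∧ weqE (G.map p)

/-- `G : D ⥤ E` is a left Quillen functor for the given classes of cofibrations and weak
equivalences (those of model structures on `D` and `E`): it has a right adjoint, and it preserves
cofibrations and trivial cofibrations. Equivalently, the adjunction between `G` and its right
adjoint is a Quillen adjunction. -/
structure IsLeftQuillen {D E : Type*} [Category* D] [Category* E] (G : D ⥤ E)
    (cofD weqD : MorphismProperty D) (cofE weqE : MorphismProperty E) : Prop where
  isLeftAdjoint : G.IsLeftAdjoint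
  map_cofibration : ∀ ⦃X Y : D⦄ (i : X ⟶ Y), cofD i → cofE (G.map i)
  map_trivialCofibration : ∀ ⦃X Y : D⦄ (i : X ⟶ Y), cofD i → weqD i →
    cofE (G.map i) ∧ weqE (G.map i)

section Fibrations

variable {A B : Type w} [SmallCategory A] [ReedyCategory A] [SmallCategory B] [ReedyCategory B]

/-- A morphism of Reedy categories: a functor that restricts to the inverse subcategories and to
the direct subcategories. -/
structure IsReedyMorphism (f : A ⥤ B) : Prop where
  map_inverse : ∀ ⦃a a' : A⦄ (g : a ⟶ a'), ReedyCategory.inverse g →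
    ReedyCategory.inverse (f.map g)
  map_direct : ∀ ⦃a a' : A⦄ (g : a ⟶ a'), ReedyCategory.direct g →
    ReedyCategory.direct (f.map g)

/-- A morphism `f : A ⥤ B` of Reedy categories is a left fibration if for every bicomplete, locally
small model category `M` (with objects in `Type u'`), the adjunction
`f_! : (A ⥤ M) ⇄ (B ⥤ M) : f^*` is a Quillen adjunction for the Reedy model structures, i.e. the
composition functor `f^*` is right Quillen. -/
structure IsLeftFibration (f : A ⥤ B) : Prop where
  isReedyMorphism : IsReedyMorphism f
  isRightQuillen : ∀ (M : Type u') [Category.{w} M] [ModelCategory M]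
    [HasLimitsOfSize.{w, w} M] [HasColimitsOfSize.{w, w} M],
    IsRightQuillen ((Functor.whiskeringLeft A B M).obj f)
      (Reedy.fibrations B M) (Reedy.weakEquivalences B M)
      (Reedy.fibrations A M) (Reedy.weakEquivalences A M)

/-- A morphism `f : A ⥤ B` of Reedy categories is a right fibration if for every bicomplete,
locally small model category `M` (with objects in `Type u'`), the adjunction
`f^* : (B ⥤ M) ⇄ (A ⥤ M) : f_*` is a Quillen adjunction for the Reedy model structures, i.e. the
composition functor `f^*` is left Quillen. -/
structure IsRightFibration (f : A ⥤ B) : Prop where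
  isReedyMorphism : IsReedyMorphism f
  isLeftQuillen : ∀ (M : Type u') [Category.{w} M] [ModelCategory M]
    [HasLimitsOfSize.{w, w} M] [HasColimitsOfSize.{w, w} M],
    IsLeftQuillen ((Functor.whiskeringLeft A B M).obj f)
      (Reedy.cofibrations B M) (Reedy.weakEquivalences B M)
      (Reedy.cofibrations A M) (Reedy.weakEquivalences A M)

variable (A)

/-- A Reedy category is left fibrant if its morphism to the terminal category is a left
fibration. -/
def IsLeftFibrant : Prop :=
  IsLeftFibration.{u', w} (Functor.star.{w} A)

/-- A Reedy category is right fibrant if its morphism to the terminal category is a right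
fibration. -/
def IsRightFibrant : Prop :=
  IsRightFibration.{u', w} (Functor.star.{w} A)

end Fibrations

/-! Everything passes through one connectedness condition. Fibrancy of a slice is tested on a single
model category: sets, with monomorphisms as cofibrations, epimorphisms as fibrations and all maps as
weak equivalences. Lifting the empty set into the point against a constant diagram of truth values
shows that every matching category is empty or connected (`IsLeftFibrant.iff`). For
`CostructuredArrow F γ` this says that the factorizations of any `F a ⟶ γ` through nonidentity
inverse morphisms out of `a` are connected. Connectedness is used in the form "an invariant
predicate is constant".

Applied to a product `F b × γ`, the condition has two consequences. Inverse morphisms of `A` become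
epimorphisms in `C` (`epi_map_of_factorizationsConnected`). Moreover, factorizations of an inverse
morphism `σ` across `CostructuredArrow.map g` correspond to factorizations of `(F σ, u) : F a ⟶ F b
× γ`: full faithfulness recovers the component in `A`, the epimorphisms give compatibility over
`γ'`, and left cancellation (`of_comp₁`) makes that component inverse. So they too are connected
(`iff_of_factorizationsConnected`).

Conversely, connected factorizations of inverse morphisms `f a ⟶ b` make `f^*` preserve Reedy
fibrations for every `M` (`HasMatchingLift.whiskerLeft`): matching data at `a` extend along `f` by
well-founded induction, with connectedness giving independence of choices. Weak equivalences are
objectwise, so trivial fibrations come for free.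

The lemmas concern arbitrary classes `P` and `Q`; the right-handed half applies them to direct
morphisms in opposite categories. -/

namespace CategoryTheory.MorphismProperty

/-- The nonidentity morphisms of a class. -/
abbrev strict {A : Type*} [Category* A] (P : MorphismProperty A) : MorphismProperty A :=
  P ⊓ (identities A)ᶜ

/-- Any two factorizations of `σ : f.obj a ⟶ b` as the image of a nonidentity morphism in `P`
followed by a morphism in `Q` are connected by morphisms in `P`: a predicate on factorizations
that is invariant under such morphisms is constant. -/
def FactorizationsConnected {A B : Type*} [Category* A] [Category* B] (f : A ⥤ B)
    (P : MorphismProperty A) (Q : MorphismProperty B) {a : A} {b : B} (σ : f.obj a ⟶ b) : Prop :=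
  ∀ R : ∀ ⦃c : A⦄ (_ : a ⟶ c) (_ : f.obj c ⟶ b), Prop,
    (∀ ⦃c c' : A⦄ (s : a ⟶ c) (r : c ⟶ c') (t : f.obj c ⟶ b) (t' : f.obj c' ⟶ b),
      P.strict s → P r → P.strict (s ≫ r) → Q t → Q t' → f.map s ≫ t = σ → f.map r ≫ t' = t →
      (R s t ↔ R (s ≫ r) t')) →
    ∀ ⦃c c' : A⦄ (s : a ⟶ c) (s' : a ⟶ c') (t : f.obj c ⟶ b) (t' : f.obj c' ⟶ b),
      P.strict s → P.strict s' → Q t → Q t' → f.map s ≫ t = σ → f.map s' ≫ t' = σ →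
      (R s t ↔ R s' t')

lemma strict_op_iff {A : Type*} [Category* A] (P : MorphismProperty A) {x y : Aᵒᵖ} (f : x ⟶ y) :
    P.op.strict f ↔ P.strict f.unop := by
  exact and_congr_right fun _ ↦ not_congr (identities_op_iff f)

/-- `y` is the target of a nonidentity morphism in `P` with source `x`. -/
def StrictlyBelow {A : Type*} [Category* A] (P : MorphismProperty A) (y x : A) : Prop :=
  ∃ s : x ⟶ y, P.strict s

/-! ### Connected factorizations and products in the target category. -/

section Epi

variable {A C : Type*} [Category* A] [Category* C] {P : MorphismProperty A} {F : A ⥤ C}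

/-- If factorizations through nonidentity morphisms in `P` are connected, then these morphisms
become epimorphisms. -/
lemma epi_map_of_factorizationsConnected [HasBinaryProducts C] (wf : WellFounded P.StrictlyBelow)
    (h : ∀ ⦃a : A⦄ ⦃γ : C⦄ (σ : F.obj a ⟶ γ), FactorizationsConnected F P ⊤ σ)
    {a b : A} (s : a ⟶ b) (hs : P s) : Epi (F.map s) := by
  induction a using wf.induction generalizing b with
  | h a ih =>
    by_cases hid : identities A s
    · cases hid
      rw [F.map_id]
      infer_instance
    refine ⟨fun {γ} v v' hv ↦ ?_⟩
    -- If `v` and `v'` agree after `F.map s`, then `(𝟙, v)` and `(𝟙, v')` complete `s` to two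
    -- factorizations of the same map into `F b × γ`. The predicate says that the second factor
    -- lands in the graph of `v`; it holds for `(𝟙, v)`, hence for `(𝟙, v')`.
    have key := h (prod.lift (F.map s) (F.map s ≫ v))
      (fun c _ t ↦ t ≫ prod.fst ≫ v = t ≫ prod.snd)
      (by
        rintro c c' s₁ r t t' hs₁ hr - - - - rfl
        -- The object `c` lies strictly below `a`, so `F.map r` is already an epimorphism and can be
        -- cancelled from the graph condition.
        have := ih c ⟨s₁, hs₁⟩ r hr
        simp only [Category.assoc, cancel_epi])
      s s (prod.lift (𝟙 _) v) (prod.lift (𝟙 _) v') ⟨hs, hid⟩ ⟨hs, hid⟩ trivial trivial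
      (by ext <;> simp) (by ext <;> simp [hv])
    simpa [prod.lift_fst, prod.lift_snd, prod.lift_fst_assoc] using key

/-- The elementary form of the connectedness of factorizations over slice categories. -/
lemma iff_of_factorizationsConnected [HasBinaryProducts C] [F.Full] [F.Faithful]
    (wf : WellFounded P.StrictlyBelow)
    (hP : ∀ ⦃a b c : A⦄ (s : a ⟶ b) (t : b ⟶ c), P s → P (s ≫ t) → P t)
    (h : ∀ ⦃a : A⦄ ⦃γ : C⦄ (σ : F.obj a ⟶ γ), FactorizationsConnected F P ⊤ σ)
    {γ γ' : C} (g : γ ⟶ γ') {a b : A} (u : F.obj a ⟶ γ) (w : F.obj b ⟶ γ') (σ : a ⟶ b)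
    (hσ : P σ) (hσw : F.map σ ≫ w = u ≫ g)
    (R : ∀ ⦃c : A⦄ (s : a ⟶ c) (v : F.obj c ⟶ γ) (t : c ⟶ b), F.map s ≫ v = u →
      F.map t ≫ w = v ≫ g → Prop)
    (hR : ∀ ⦃c c' : A⦄ (s : a ⟶ c) (r : c ⟶ c') (v : F.obj c ⟶ γ) (v' : F.obj c' ⟶ γ)
      (t : c ⟶ b) (t' : c' ⟶ b), P.strict s → P r → P.strict (s ≫ r) → P t → P t' →
      s ≫ t = σ → r ≫ t' = t → F.map r ≫ v' = v → ∀ h₁ h₂ h₃ h₄,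
      (R s v t h₁ h₂ ↔ R (s ≫ r) v' t' h₃ h₄))
    ⦃c c' : A⦄ (s : a ⟶ c) (s' : a ⟶ c') (v : F.obj c ⟶ γ) (v' : F.obj c' ⟶ γ)
    (t : c ⟶ b) (t' : c' ⟶ b) (hs : P.strict s) (hs' : P.strict s')
    (hst : s ≫ t = σ) (hst' : s' ≫ t' = σ) (h₁ h₂ h₃ h₄) :
    R s v t h₁ h₂ ↔ R s' v' t' h₃ h₄ := by
  -- A map into `F b × γ` is a pair consisting of a morphism to `b` (by fullness) and a structure
  -- map to `γ`. The existential restricts `R` to pairs compatible over `γ'`, where it is defined.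
  have key := h (prod.lift (F.map σ) u)
    (fun c s t ↦ ∃ h₁ h₂, R s (t ≫ prod.snd) (F.preimage (t ≫ prod.fst)) h₁ h₂)
    (by
      rintro c d s₁ r _ k hs₁ hr hsr - - hk rfl
      have e₁ : F.map s₁ ≫ F.map r ≫ k ≫ prod.snd = u := by
        simpa [prod.lift_snd] using hk =≫ prod.snd
      have e₂ : s₁ ≫ r ≫ F.preimage (k ≫ prod.fst) = σ :=
        F.map_injective (by simpa [prod.lift_fst] using hk =≫ prod.fst)
      have e₃ : F.preimage ((F.map r ≫ k) ≫ prod.fst) = r ≫ F.preimage (k ≫ prod.fst) :=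
        F.map_injective (by simp)
      have P₂ : P (F.preimage (k ≫ prod.fst)) := hP _ _ hsr.1 (by simpa [e₂] using hσ)
      have P₁ : P (r ≫ F.preimage (k ≫ prod.fst)) := hP _ _ hs₁.1 (by simpa [e₂] using hσ)
      have := epi_map_of_factorizationsConnected wf h _ hs₁.1
      have := epi_map_of_factorizationsConnected wf h _ hr
      have f₁ : F.map s₁ ≫ (F.map r ≫ k) ≫ prod.snd = u := by simpa using e₁
      have f₃ : F.map (s₁ ≫ r) ≫ k ≫ prod.snd = u := by simpa using e₁
      -- Compatibility over `γ'` holds after precomposition with `s₁ ≫ r`, where it becomes `hσw`;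
      -- the two epimorphisms then cancel.
      have f₄ : F.map (F.preimage (k ≫ prod.fst)) ≫ w = (k ≫ prod.snd) ≫ g := by
        rw [← cancel_epi (F.map r), ← cancel_epi (F.map s₁), ← F.map_comp_assoc,
          ← F.map_comp_assoc, Category.assoc, e₂, hσw, ← e₁]
        simp
      have f₂ : F.map (F.preimage ((F.map r ≫ k) ≫ prod.fst)) ≫ w =
          ((F.map r ≫ k) ≫ prod.snd) ≫ g := by
        rw [e₃, F.map_comp_assoc, f₄]
        simp
      have := hR s₁ r ((F.map r ≫ k) ≫ prod.snd) (k ≫ prod.snd)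
        (F.preimage ((F.map r ≫ k) ≫ prod.fst)) (F.preimage (k ≫ prod.fst)) hs₁ hr hsr
        (by rwa [e₃]) P₂ (by rwa [e₃]) e₃.symm (by simp) f₁ f₂ f₃ f₄
      exact ⟨fun ⟨_, _, k⟩ ↦ ⟨_, _, this.1 k⟩, fun ⟨_, _, k⟩ ↦ ⟨_, _, this.2 k⟩⟩)
    s s' (prod.lift (F.map t) v) (prod.lift (F.map t') v') hs hs' trivial trivial
    (by ext <;> simp [← hst, h₁]) (by ext <;> simp [← hst', h₃])
  simpa [prod.lift_fst, prod.lift_snd, prod.lift_fst_assoc, prod.lift_snd_assoc, h₁, h₂, h₃, h₄]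
    using key

end Epi

/-! ### Transfer of matching lifts along a functor. -/

section Lift

variable {B M : Type*} [Category* B] [Category* M]

/-- Elementary form of the lifting property of a relative matching map with respect to `i`. -/
def HasMatchingLift (P : MorphismProperty B) {X Y : B ⥤ M} (φ : X ⟶ Y) {K L : M} (i : K ⟶ L)
    (b : B) : Prop :=
  ∀ (p : K ⟶ X.obj b) (q : L ⟶ Y.obj b)
    (l : ∀ ⦃c : B⦄ (t : b ⟶ c), P.strict t → (L ⟶ X.obj c)),
    i ≫ q = p ≫ φ.app b →
    (∀ ⦃c : B⦄ (t : b ⟶ c) (ht : P.strict t), i ≫ l t ht = p ≫ X.map t) →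
    (∀ ⦃c : B⦄ (t : b ⟶ c) (ht : P.strict t), l t ht ≫ φ.app c = q ≫ Y.map t) →
    (∀ ⦃c d : B⦄ (t : b ⟶ c) (r : c ⟶ d) (ht : P.strict t) (ht' : P.strict (t ≫ r)), P r →
      l t ht ≫ X.map r = l (t ≫ r) ht') →
    ∃ k : L ⟶ X.obj b, i ≫ k = p ∧ k ≫ φ.app b = q ∧
      ∀ ⦃c : B⦄ (t : b ⟶ c) (ht : P.strict t), k ≫ X.map t = l t ht

variable {A : Type*} [Category* A] {f : A ⥤ B} {P : MorphismProperty A}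
  {Q : MorphismProperty B} {X Y : B ⥤ M} {φ : X ⟶ Y} {K L : M} {i : K ⟶ L}

/-- The extension along `f` of a family `l` of morphisms `L ⟶ X.obj (f.obj c)`, indexed by the
nonidentity morphisms `a ⟶ c` in `P`, to morphisms `L ⟶ X.obj b`, indexed by the morphisms
`f.obj a ⟶ b` in `Q`: the family is composed with structure morphisms where possible, and lifts
are chosen elsewhere. -/
inductive MatchingExtension {a : A} (f : A ⥤ B) (P : MorphismProperty A)
    (Q : MorphismProperty B) (φ : X ⟶ Y) (i : K ⟶ L)
    (p : K ⟶ X.obj (f.obj a)) (q : L ⟶ Y.obj (f.obj a))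
    (l : ∀ ⦃c : A⦄ (t : a ⟶ c), P.strict t → (L ⟶ X.obj (f.obj c))) :
    ∀ ⦃b : B⦄ (_ : f.obj a ⟶ b) (_ : L ⟶ X.obj b), Prop
  | comp ⦃b : B⦄ (σ : f.obj a ⟶ b) ⦃c : A⦄ (s : a ⟶ c) (hs : P.strict s) (t : f.obj c ⟶ b)
      (ht : Q t) (hst : f.map s ≫ t = σ) : MatchingExtension f P Q φ i p q l σ (l s hs ≫ X.map t)
  | lift ⦃b : B⦄ (σ : f.obj a ⟶ b)
      (hσ : ∀ ⦃c : A⦄ (s : a ⟶ c) (_ : P.strict s) (t : f.obj c ⟶ b) (_ : Q t), f.map s ≫ t ≠ σ)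
      (m : ∀ ⦃c : B⦄ (t : b ⟶ c), Q.strict t → (L ⟶ X.obj c))
      (hm : ∀ ⦃c : B⦄ (t : b ⟶ c) (ht : Q.strict t),
        MatchingExtension f P Q φ i p q l (σ ≫ t) (m t ht))
      (hk : ∃ k : L ⟶ X.obj b, i ≫ k = p ≫ X.map σ ∧ k ≫ φ.app b = q ≫ Y.map σ ∧
        ∀ ⦃c : B⦄ (t : b ⟶ c) (ht : Q.strict t), k ≫ X.map t = m t ht) :
      MatchingExtension f P Q φ i p q l σ hk.choose

/-- Well-founded induction on `b`: the values below `b` form a matching family, which the lifting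
hypothesis at `b` extends. Uniqueness and compatibility with further morphisms in `Q` are proved in
the same induction because they are what makes those values a matching family. -/
lemma exists_matchingExtension [Q.IsMultiplicative] (wf : WellFounded Q.StrictlyBelow)
    (conn : ∀ ⦃a : A⦄ ⦃b : B⦄ (σ : f.obj a ⟶ b), Q σ → FactorizationsConnected f P Q σ)
    (h : ∀ b, HasMatchingLift Q φ i b) {a : A}
    {p : K ⟶ X.obj (f.obj a)} {q : L ⟶ Y.obj (f.obj a)}
    {l : ∀ ⦃c : A⦄ (t : a ⟶ c), P.strict t → (L ⟶ X.obj (f.obj c))}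
    (hpq : i ≫ q = p ≫ φ.app _)
    (hp : ∀ ⦃c : A⦄ (t : a ⟶ c) (ht : P.strict t), i ≫ l t ht = p ≫ X.map (f.map t))
    (hq : ∀ ⦃c : A⦄ (t : a ⟶ c) (ht : P.strict t), l t ht ≫ φ.app _ = q ≫ Y.map (f.map t))
    (hl : ∀ ⦃c d : A⦄ (t : a ⟶ c) (r : c ⟶ d) (ht : P.strict t) (ht' : P.strict (t ≫ r)), P r →
      l t ht ≫ X.map (f.map r) = l (t ≫ r) ht')
    {b : B} (σ : f.obj a ⟶ b) (hσ : Q σ) :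
    ∃ k : L ⟶ X.obj b, MatchingExtension f P Q φ i p q l σ k ∧
      (∀ k', MatchingExtension f P Q φ i p q l σ k' → k' = k) ∧
      i ≫ k = p ≫ X.map σ ∧ k ≫ φ.app b = q ≫ Y.map σ ∧
      ∀ ⦃c : B⦄ (t : b ⟶ c), Q t → MatchingExtension f P Q φ i p q l (σ ≫ t) (k ≫ X.map t) := by
  induction b using wf.induction with
  | h b ih =>
    by_cases hfac : ∃ (c : A) (s : a ⟶ c) (_ : P.strict s) (t : f.obj c ⟶ b) (_ : Q t),
      f.map s ≫ t = σ
    · obtain ⟨c, s, hs, t, ht, hst⟩ := hfac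
      refine ⟨l s hs ≫ X.map t, .comp σ s hs t ht hst, ?_, ?_, ?_, fun d t' ht' ↦ ?_⟩
      · rintro _ (⟨_, s', hs', t', ht', hst'⟩ | ⟨_, hno, -, -, -⟩)
        -- The composite does not depend on the factorization: by `hl`, agreement with the fixed
        -- composite is invariant, so connectedness propagates it.
        · exact (conn σ hσ (fun c' s₁ t₁ ↦ ∀ h₁, l s₁ h₁ ≫ X.map t₁ = l s hs ≫ X.map t)
            (by
              rintro c₁ c₂ s₁ r _ t₁ hs₁ hr hsr - - - rfl
              simp only [hs₁, hsr, forall_true_left, X.map_comp, ← hl s₁ r hs₁ hsr hr,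
                Category.assoc])
            s s' t t' hs hs' ht ht' hst hst').1 (fun _ ↦ rfl) hs'
        · exact (hno s hs t ht hst).elim
      · rw [← Category.assoc, hp, Category.assoc, ← X.map_comp, hst]
      · rw [Category.assoc, φ.naturality, ← Category.assoc, hq, Category.assoc, ← Y.map_comp, hst]
      · simpa using MatchingExtension.comp (σ ≫ t') s hs (t ≫ t') (Q.comp_mem _ _ ht ht')
          (by rw [← hst, Category.assoc])
    · push Not at hfac
      have ih' : ∀ ⦃c : B⦄ (t : b ⟶ c) (ht : Q.strict t), _ :=
        fun c t ht ↦ ih c ⟨t, ht⟩ (σ ≫ t) (Q.comp_mem _ _ hσ ht.1)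
      choose m hm₁ hm₂ hm₃ hm₄ hm₅ using ih'
      have hk := h b (p ≫ X.map σ) (q ≫ Y.map σ) m (by
          rw [← Category.assoc, hpq, Category.assoc, Category.assoc, φ.naturality])
        (fun c t ht ↦ by simp [hm₃]) (fun c t ht ↦ by simp [hm₄])
        (fun c d t r ht ht' hr ↦ hm₂ _ _ _ (by simpa using hm₅ t ht r hr))
      refine ⟨hk.choose, .lift σ hfac m hm₁ hk, ?_, hk.choose_spec.1, hk.choose_spec.2.1,
        fun d t ht ↦ ?_⟩
      · rintro _ (⟨_, s', hs', t', ht', hst'⟩ | ⟨_, hno, m', hm', hk'⟩)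
        · exact (hfac _ s' hs' t' ht' hst').elim
        -- The values below `b` are unique by induction. Once they agree, the two existence
        -- statements coincide by proof irrelevance, and so do the chosen lifts.
        · obtain rfl : m' = m := by
            funext c t ht
            exact hm₂ _ _ _ (hm' t ht)
          rfl
      · by_cases hid : identities B t
        · cases hid
          simpa using MatchingExtension.lift σ hfac m hm₁ hk
        · rw [hk.choose_spec.2.2 t ⟨ht, hid⟩]
          exact hm₁ t ⟨ht, hid⟩

/-- The required lift is the value of the extended family at the identity of `f.obj a`. -/
lemma HasMatchingLift.whiskerLeft [Q.IsMultiplicative]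
    (hf : ∀ ⦃a a' : A⦄ (s : a ⟶ a'), P s → Q (f.map s)) (wf : WellFounded Q.StrictlyBelow)
    (conn : ∀ ⦃a : A⦄ ⦃b : B⦄ (σ : f.obj a ⟶ b), Q σ → FactorizationsConnected f P Q σ)
    (h : ∀ b, HasMatchingLift Q φ i b) (a : A) :
    HasMatchingLift P (Functor.whiskerLeft f φ) i a := by
  intro p q l hpq hp hq hl
  obtain ⟨k, -, -, hk₁, hk₂, hk₃⟩ :=
    exists_matchingExtension wf conn h hpq hp hq hl (𝟙 _) (Q.id_mem _)
  refine ⟨k, by simpa using hk₁, by simpa using hk₂, fun c t ht ↦ ?_⟩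
  obtain ⟨k', -, hk', -⟩ :=
    exists_matchingExtension wf conn h hpq hp hq hl (f.map t) (hf _ ht.1)
  -- At `f.map t` the extension takes both the value transported from the identity and the
  -- prescribed `l t ht`; uniqueness identifies them.
  refine (hk' _ (by simpa using hk₃ (f.map t) (hf _ ht.1))).trans (hk' _ ?_).symm
  simpa using MatchingExtension.comp (f.map t) t ht (𝟙 _) (Q.id_mem _) (by simp)

end Lift

end CategoryTheory.MorphismProperty

/-! ### Well-foundedness and cancellation in Reedy structures. -/

namespace HomotopicalAlgebra.ReedyStructure

variable {A : Type*} [Category* A] {W₁ W₂ : MorphismProperty A}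
  [W₁.IsMultiplicative] [W₂.IsMultiplicative]
  {α : Type*} [LinearOrder α] [OrderBot α] [SuccOrder α] [WellFoundedLT α]

lemma wellFounded_strictlyBelow (r : ReedyStructure W₁ W₂ α) : WellFounded W₁.StrictlyBelow :=
  Subrelation.wf (r := fun y x ↦ r.deg y < r.deg x) (fun ⟨s, hs⟩ ↦ r.lt₁ s hs.1 hs.2)
    (InvImage.wf r.deg wellFounded_lt)

/-- Factor `t` as `i ≫ p`. Then `(s ≫ i, p)` and `(s ≫ t, 𝟙)` both factor `s ≫ t`, so uniqueness
makes `p` an identity up to equality of objects. -/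
lemma of_comp₁ (r : ReedyStructure W₁ W₂ α) {a b c : A} (s : a ⟶ b) (t : b ⟶ c) (hs : W₁ s)
    (hst : W₁ (s ≫ t)) : W₁ t := by
  obtain ⟨z, i, p, hi, hp, rfl, -⟩ := r.exists_fac t
  obtain ⟨e, -, h⟩ := r.unique (f := s ≫ i ≫ p)
    ⟨z, s ≫ i, p, by simp, W₁.comp_mem _ _ hs hi, hp⟩
    ⟨c, s ≫ i ≫ p, 𝟙 _, by simp, hst, W₂.id_mem _⟩
  dsimp at e h
  subst e
  simpa [h] using hi

end HomotopicalAlgebra.ReedyStructure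

/-! ### Relative matching and latching maps in terms of lifting data. -/

namespace Reedy

open MorphismProperty

variable {A : Type w} [SmallCategory A] [ReedyCategory A] {M : Type u'} [Category.{w} M]

/-- By the universal properties of the pullback and the limit, a map from `L` to the target of the
relative matching map is a map to `Y.obj a` together with a compatible family of maps to the `X.obj
b`. -/
lemma hasLiftingProperty_relativeMatchingMap_iff [HasLimitsOfSize.{w, w} M] [HasPullbacks M]
    {X Y : A ⥤ M} (φ : X ⟶ Y) {K L : M} (i : K ⟶ L) (a : A) :
    HasLiftingProperty i (relativeMatchingMap φ a) ↔
      HasMatchingLift ReedyCategory.inverse φ i a := by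
  have hπ (b : MatchingCategory a) : matchingMap X a ≫ limit.π _ b = X.map b.hom :=
    limit.lift_π (matchingCone X a) b
  have hπ' (b : MatchingCategory a) : matchingMap Y a ≫ limit.π _ b = Y.map b.hom :=
    limit.lift_π (matchingCone Y a) b
  have hφ (b : MatchingCategory a) :
      matchingObjMap φ a ≫ limit.π _ b = limit.π _ b ≫ φ.app b.right :=
    limMap_π (Functor.whiskerLeft (matchingForget a) φ) b
  have hfst : relativeMatchingMap φ a ≫ pullback.fst _ _ = matchingMap X a :=
    pullback.lift_fst _ _ _
  have hsnd : relativeMatchingMap φ a ≫ pullback.snd _ _ = φ.app a :=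
    pullback.lift_snd _ _ _
  constructor
  · intro _ p q l hpq hp hq hl
    let c : Cone (matchingForget a ⋙ X) :=
      { pt := L
        π :=
          { app := fun b ↦ l b.hom b.prop
            naturality := fun b b' g ↦ by
              have hw := MorphismProperty.Under.w g
              have := hl b.hom g.right b.prop (by rw [hw]; exact b'.prop) g.prop_hom_right
              refine (Category.id_comp _).trans (Eq.trans ?_ this.symm)
              congr 1
              exact hw.symm } }
    have hc (b : MatchingCategory a) : limit.lift _ c ≫ limit.π _ b = l b.hom b.prop :=
      limit.lift_π c b
    have hcq : limit.lift _ c ≫ matchingObjMap φ a = q ≫ matchingMap Y a := by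
      apply limit.hom_ext
      intro b
      rw [Category.assoc, Category.assoc, hφ, hπ']
      exact (Category.assoc _ _ _).symm.trans
        ((congrArg (· ≫ φ.app b.right) (hc b)).trans (hq _ _))
    have sq : CommSq p i (relativeMatchingMap φ a) (pullback.lift (limit.lift _ c) q hcq) := by
      constructor
      apply pullback.hom_ext
      · rw [Category.assoc, Category.assoc, hfst, pullback.lift_fst]
        apply limit.hom_ext
        intro b
        rw [Category.assoc, Category.assoc, hπ, hc]
        exact (hp _ _).symm
      · rw [Category.assoc, Category.assoc, hsnd, pullback.lift_snd, hpq]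
    have h₁ : sq.lift ≫ matchingMap X a = limit.lift _ c := by
      rw [← hfst, ← Category.assoc, sq.fac_right, pullback.lift_fst]
    refine ⟨sq.lift, sq.fac_left, ?_, fun b t ht ↦ ?_⟩
    · rw [← hsnd, ← Category.assoc, sq.fac_right, pullback.lift_snd]
    · have := hπ (MorphismProperty.Under.mk _ t ht)
      exact (congrArg (sq.lift ≫ ·) this).symm.trans ((Category.assoc _ _ _).symm.trans
        ((congrArg (· ≫ limit.π _ _) h₁).trans (hc (MorphismProperty.Under.mk _ t ht))))
  · intro h
    constructor
    intro p g sq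
    have hg₁ := sq.w =≫ pullback.fst _ _
    have hg₂ := sq.w =≫ pullback.snd _ _
    rw [Category.assoc, Category.assoc, hfst] at hg₁
    rw [Category.assoc, Category.assoc, hsnd] at hg₂
    obtain ⟨k, hk₁, hk₂, hk₃⟩ := h p (g ≫ pullback.snd _ _)
      (fun b t ht ↦ (g ≫ pullback.fst _ _) ≫ limit.π _ (MorphismProperty.Under.mk _ t ht))
      hg₂.symm
      (fun b t ht ↦ by
        have := hg₁ =≫ limit.π _ (MorphismProperty.Under.mk _ t ht)
        rw [Category.assoc, Category.assoc, hπ] at this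
        exact this.symm)
      (fun b t ht ↦ by
        have h₁ := hφ (MorphismProperty.Under.mk _ t ht)
        have h₂ := hπ' (MorphismProperty.Under.mk _ t ht)
        have h₃ := pullback.condition (f := matchingObjMap φ a) (g := matchingMap Y a) =≫
          limit.π _ (MorphismProperty.Under.mk _ t ht)
        rw [Category.assoc, Category.assoc, h₁, h₂] at h₃
        refine (Category.assoc _ _ _).trans ((Category.assoc _ _ _).trans ?_)
        exact (congrArg (g ≫ ·) h₃).trans (Category.assoc _ _ _).symm)
      (fun b c t r ht ht' hr ↦ by
        have := limit.w (matchingForget a ⋙ X)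
          (MorphismProperty.Under.homMk r rfl hr : MorphismProperty.Under.mk _ t ht ⟶
            MorphismProperty.Under.mk _ (t ≫ r) ht')
        exact (Category.assoc _ _ _).trans (congrArg ((g ≫ pullback.fst _ _) ≫ ·) this))
    refine ⟨⟨⟨k, hk₁, ?_⟩⟩⟩
    apply pullback.hom_ext
    · rw [Category.assoc, hfst]
      apply limit.hom_ext
      intro b
      rw [Category.assoc, hπ]
      exact hk₃ b.hom b.prop
    · rw [Category.assoc, hsnd, hk₂]

/-- A latching lift is a matching lift in the opposite categories, which lets the transfer argument
serve both halves. -/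
lemma hasLiftingProperty_relativeLatchingMap_iff [HasColimitsOfSize.{w, w} M] [HasPushouts M]
    {X Y : A ⥤ M} (φ : X ⟶ Y) {K L : M} (p : K ⟶ L) (a : A) :
    HasLiftingProperty (relativeLatchingMap φ a) p ↔
      HasMatchingLift (ReedyCategory.direct (A := A)).op (NatTrans.op φ) p.op (.op a) := by
  have hι (b : LatchingCategory a) : colimit.ι _ b ≫ latchingMap X a = X.map b.hom :=
    colimit.ι_desc (latchingCocone X a) b
  have hι' (b : LatchingCategory a) : colimit.ι _ b ≫ latchingMap Y a = Y.map b.hom :=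
    colimit.ι_desc (latchingCocone Y a) b
  have hφ (b : LatchingCategory a) :
      colimit.ι _ b ≫ latchingObjMap φ a =
        (Functor.whiskerLeft (latchingForget a) φ).app b ≫ colimit.ι (latchingForget a ⋙ Y) b :=
    ι_colimMap (Functor.whiskerLeft (latchingForget a) φ) b
  have hinl : pushout.inl _ _ ≫ relativeLatchingMap φ a = φ.app a :=
    pushout.inl_desc _ _ _
  have hinr : pushout.inr _ _ ≫ relativeLatchingMap φ a = latchingMap Y a :=
    pushout.inr_desc _ _ _
  have hop {b : A} (t : b ⟶ a) :
      (ReedyCategory.direct (A := A)).strict t ↔ (ReedyCategory.direct (A := A)).op.strict t.op :=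
    (strict_op_iff _ _).symm
  constructor
  · intro _ q s l hpq hp hq hl
    let c : Cocone (latchingForget a ⋙ Y) :=
      { pt := K
        ι :=
          { app := fun b ↦ (l b.hom.op ((hop _).1 b.prop)).unop
            naturality := fun b b' g ↦ by
              have hw := MorphismProperty.Over.w g
              have := hl b'.hom.op g.left.op ((hop _).1 b'.prop)
                ((hop (g.left ≫ b'.hom)).1 (by rw [hw]; exact b.prop)) g.prop_hom_left
              refine Eq.trans ?_ (Category.comp_id _).symm
              refine (congrArg Quiver.Hom.unop this).trans ?_
              congr 2
              exact congrArg Quiver.Hom.op hw } }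
    have hc (b : LatchingCategory a) :
        colimit.ι _ b ≫ colimit.desc _ c = (l b.hom.op ((hop _).1 b.prop)).unop :=
      colimit.ι_desc c b
    have hcq : latchingMap X a ≫ s.unop = latchingObjMap φ a ≫ colimit.desc _ c := by
      apply colimit.hom_ext
      intro b
      rw [← Category.assoc, ← Category.assoc, hφ, hι, Category.assoc, hc]
      exact congrArg Quiver.Hom.unop (hq b.hom.op ((hop _).1 b.prop)).symm
    have sq : CommSq (pushout.desc s.unop (colimit.desc _ c) hcq) (relativeLatchingMap φ a)
        p q.unop := by
      constructor
      apply pushout.hom_ext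
      · rw [← Category.assoc, ← Category.assoc, hinl, pushout.inl_desc]
        exact congrArg Quiver.Hom.unop hpq
      · rw [← Category.assoc, ← Category.assoc, hinr, pushout.inr_desc]
        apply colimit.hom_ext
        intro b
        rw [← Category.assoc, ← Category.assoc, hι', hc]
        exact congrArg Quiver.Hom.unop (hp b.hom.op ((hop _).1 b.prop))
    have h₁ : latchingMap Y a ≫ sq.lift = colimit.desc _ c := by
      rw [← hinr, Category.assoc, sq.fac_left, pushout.inr_desc]
    refine ⟨sq.lift.op, congrArg Quiver.Hom.op sq.fac_right, Quiver.Hom.unop_inj ?_,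
      fun b t ht ↦ Quiver.Hom.unop_inj ?_⟩
    · change φ.app a ≫ sq.lift = s.unop
      rw [← hinl, Category.assoc, sq.fac_left, pushout.inl_desc]
    · have := hι' (MorphismProperty.Over.mk _ t.unop ((hop _).2 ht))
      exact (congrArg (· ≫ sq.lift) this).symm.trans ((Category.assoc _ _ _).trans
        ((congrArg (colimit.ι _ _ ≫ ·) h₁).trans
          (hc (MorphismProperty.Over.mk _ t.unop ((hop _).2 ht)))))
  · intro h
    constructor
    intro g q sq
    have hg₁ := congrArg (pushout.inl _ _ ≫ ·) sq.w
    have hg₂ := congrArg (pushout.inr _ _ ≫ ·) sq.w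
    rw [← Category.assoc, ← Category.assoc, hinl] at hg₁
    rw [← Category.assoc, ← Category.assoc, hinr] at hg₂
    obtain ⟨k, hk₁, hk₂, hk₃⟩ := h q.op (pushout.inl _ _ ≫ g).op
      (fun b t ht ↦ (colimit.ι _ (MorphismProperty.Over.mk _ t.unop ((hop _).2 ht)) ≫
        pushout.inr _ _ ≫ g).op)
      (congrArg Quiver.Hom.op hg₁)
      (fun b t ht ↦ by
        have := congrArg (colimit.ι _ (MorphismProperty.Over.mk _ t.unop ((hop _).2 ht)) ≫ ·) hg₂
        dsimp only at this
        rw [← Category.assoc, ← Category.assoc _ _ q, hι'] at this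
        exact congrArg Quiver.Hom.op this)
      (fun b t ht ↦ by
        have h₁ := hφ (MorphismProperty.Over.mk _ t.unop ((hop _).2 ht))
        have h₂ := hι (MorphismProperty.Over.mk _ t.unop ((hop _).2 ht))
        have h₃ := congrArg
          (colimit.ι _ (MorphismProperty.Over.mk _ t.unop ((hop _).2 ht)) ≫ ·)
          (pushout.condition (f := latchingMap X a) (g := latchingObjMap φ a))
        dsimp only at h₃
        rw [← Category.assoc, ← Category.assoc, h₁, h₂] at h₃
        have h₄ := congrArg (· ≫ g) h₃
        simp only [Category.assoc] at h₄
        exact congrArg Quiver.Hom.op (h₄.symm.trans (Category.assoc _ _ _)))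
      (fun b c t r ht ht' hr ↦ by
        have := colimit.w (latchingForget a ⋙ Y)
          (MorphismProperty.Over.homMk r.unop rfl hr :
            MorphismProperty.Over.mk _ (t ≫ r).unop ((hop _).2 ht') ⟶
              MorphismProperty.Over.mk _ t.unop ((hop _).2 ht))
        exact congrArg Quiver.Hom.op ((Category.assoc _ _ _).symm.trans
          (congrArg (· ≫ pushout.inr _ _ ≫ g) this)))
    refine ⟨⟨⟨k.unop, ?_, congrArg Quiver.Hom.unop hk₁⟩⟩⟩
    apply pushout.hom_ext
    · rw [← Category.assoc, hinl]
      exact congrArg Quiver.Hom.unop hk₂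
    · rw [← Category.assoc, hinr]
      apply colimit.hom_ext
      intro b
      rw [← Category.assoc, hι']
      exact congrArg Quiver.Hom.unop (hk₃ b.hom.op ((hop _).1 b.prop))

end Reedy

/-! ### The test model structure on types. -/

lemma CategoryTheory.Types.hasLiftingProperty_of_mono_of_epi {A B X Y : Type u} (i : A ⟶ B)
    (p : X ⟶ Y) [Mono i] [Epi p] : HasLiftingProperty i p where
  sq_hasLift {f g} sq := by
    classical
    have hi := (mono_iff_injective i).1 inferInstance
    have hp := (epi_iff_surjective p).1 inferInstance
    have hw (a : A) : p (f a) = g (i a) := ConcreteCategory.congr_hom sq.w a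
    refine ⟨⟨⟨↾ fun b ↦ if h : ∃ a, i a = b then f h.choose else (hp (g b)).choose, ?_, ?_⟩⟩⟩
    · ext a
      have h : ∃ a', i a' = i a := ⟨a, rfl⟩
      have := hi h.choose_spec
      simp [this]
    · ext b
      by_cases h : ∃ a, i a = b
      · have := h.choose_spec
        simp [dif_pos h, hw, this]
      · simpa [dif_neg h] using (hp (g b)).choose_spec

lemma CategoryTheory.Types.exists_mono_epi_fac {X Y : Type u} (f : X ⟶ Y) :
    ∃ (Z : Type u) (i : X ⟶ Z) (p : Z ⟶ Y), Mono i ∧ Epi p ∧ i ≫ p = f :=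
  ⟨X ⊕ Y, ↾ Sum.inl, ↾ Sum.elim f id, (mono_iff_injective _).2 Sum.inl_injective,
    (epi_iff_surjective _).2 fun y ↦ ⟨Sum.inr y, rfl⟩, rfl⟩

/-- The model structure on types whose cofibrations are the monomorphisms, whose fibrations are
the epimorphisms and for which all morphisms are weak equivalences. -/
abbrev HomotopicalAlgebra.monoEpiModelCategory : ModelCategory (Type u) where
  categoryWithFibrations := ⟨MorphismProperty.epimorphisms _⟩
  categoryWithCofibrations := ⟨MorphismProperty.monomorphisms _⟩
  categoryWithWeakEquivalences := ⟨⊤⟩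
  cm2 :=
    { comp_mem := fun _ _ _ _ ↦ trivial
      of_postcomp := fun _ _ _ _ ↦ trivial
      of_precomp := fun _ _ _ _ ↦ trivial }
  cm3a := ⟨fun _ _ ↦ trivial⟩
  cm3b := inferInstanceAs (MorphismProperty.epimorphisms _).IsStableUnderRetracts
  cm3c := inferInstanceAs (MorphismProperty.monomorphisms _).IsStableUnderRetracts
  cm4a i p hi _ hp :=
    have : Mono i := hi.mem
    have : Epi p := hp.mem
    Types.hasLiftingProperty_of_mono_of_epi i p
  cm4b i p hi hp _ :=
    have : Mono i := hi.mem
    have : Epi p := hp.mem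
    Types.hasLiftingProperty_of_mono_of_epi i p
  cm5a := ⟨fun f ↦ by
    obtain ⟨Z, i, p, hi, hp, fac⟩ := Types.exists_mono_epi_fac f
    exact ⟨⟨Z, i, p, fac, ⟨hi, trivial⟩, hp⟩⟩⟩
  cm5b := ⟨fun f ↦ by
    obtain ⟨Z, i, p, hi, hp, fac⟩ := Types.exists_mono_epi_fac f
    exact ⟨⟨Z, i, p, fac, hi, ⟨hp, trivial⟩⟩⟩⟩

/-! ### Reedy (co)fibrations by lifting, and connectedness from fibrancy. -/

section

open MorphismProperty

variable {A : Type w} [SmallCategory A] [ReedyCategory A]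

/-- Fibrations are the maps with the right lifting property against trivial cofibrations. The test
maps `i` live in `M` and do not involve the diagram shape, so preservation can be checked for each
`i` separately. -/
lemma Reedy.mem_fibrations_iff {M : Type u'} [Category.{w} M] [ModelCategory M]
    [HasLimitsOfSize.{w, w} M] {X Y : A ⥤ M} (φ : X ⟶ Y) :
    Reedy.fibrations A M φ ↔ ∀ ⦃K L : M⦄ (i : K ⟶ L), trivialCofibrations M i →
      ∀ a, HasMatchingLift ReedyCategory.inverse φ i a := by
  simp only [Reedy.fibrations, ← Reedy.hasLiftingProperty_relativeMatchingMap_iff]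
  refine ⟨fun h K L i hi a ↦ ?_, fun h a ↦ ?_⟩
  · exact hasLiftingProperty_of_wfs _ _ hi (h a)
  · rw [← rlp_eq_of_wfs (trivialCofibrations M) (HomotopicalAlgebra.fibrations M)]
    exact fun K L i hi ↦ h i hi a

lemma Reedy.mem_cofibrations_iff {M : Type u'} [Category.{w} M] [ModelCategory M]
    [HasColimitsOfSize.{w, w} M] {X Y : A ⥤ M} (φ : X ⟶ Y) :
    Reedy.cofibrations A M φ ↔ ∀ ⦃K L : M⦄ (p : K ⟶ L), trivialFibrations M p →
      ∀ a : A, HasMatchingLift (ReedyCategory.direct (A := A)).op (NatTrans.op φ) p.op (.op a) := by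
  simp only [Reedy.cofibrations, ← Reedy.hasLiftingProperty_relativeLatchingMap_iff]
  refine ⟨fun h K L i hi a ↦ ?_, fun h a ↦ ?_⟩
  · exact hasLiftingProperty_of_wfs _ _ (h a) hi
  · rw [← llp_eq_of_wfs (HomotopicalAlgebra.cofibrations M) (trivialFibrations M)]
    exact fun K L i hi ↦ h i hi a

lemma ReedyCategory.not_strict_terminal {P : MorphismProperty (Discrete PUnit.{w + 1})}
    {x y : Discrete PUnit.{w + 1}} (t : x ⟶ y) : ¬ P.strict t := by
  obtain ⟨⟨⟩⟩ := x
  obtain ⟨⟨⟩⟩ := y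
  obtain rfl : t = 𝟙 _ := Subsingleton.elim _ _
  exact fun h ↦ h.2 (by constructor)

/-- The matching categories of a left fibrant Reedy category are empty or connected. -/
lemma IsLeftFibrant.iff (h : IsLeftFibrant.{w + 1, w} A) {a : A}
    (R : ∀ ⦃c : A⦄ (_ : a ⟶ c), Prop)
    (hR : ∀ ⦃c c' : A⦄ (s : a ⟶ c) (r : c ⟶ c'), ReedyCategory.inverse.strict s →
      ReedyCategory.inverse r → ReedyCategory.inverse.strict (s ≫ r) → (R s ↔ R (s ≫ r)))
    ⦃c c' : A⦄ (s : a ⟶ c) (s' : a ⟶ c') (hs : ReedyCategory.inverse.strict s)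
    (hs' : ReedyCategory.inverse.strict s') : R s ↔ R s' := by
  let _ : ModelCategory (Type w) := monoEpiModelCategory
  let φ : ULift.{w} Prop ⟶ PUnit.{w + 1} := ↾ fun _ ↦ ⟨⟩
  let i : PEmpty.{w + 1} ⟶ PUnit.{w + 1} := ↾ PEmpty.elim
  have : Epi φ := (epi_iff_surjective _).2 fun _ ↦ ⟨⟨True⟩, rfl⟩
  have hi : trivialCofibrations (Type w) i := ⟨(mono_iff_injective _).2 (fun x ↦ x.elim), trivial⟩
  -- Over the terminal category there are no nonidentity morphisms, so the matching conditions are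
  -- vacuous and any epimorphism is a Reedy fibration.
  have hφ : Reedy.fibrations (Discrete PUnit.{w + 1}) (Type w)
      ((Functor.const (Discrete PUnit.{w + 1})).map φ) := by
    rw [Reedy.mem_fibrations_iff]
    intro K L j hj x p q l hpq _ _ _
    have : Mono j := hj.1
    have := Types.hasLiftingProperty_of_mono_of_epi j φ
    have sq : CommSq p j φ q := ⟨hpq.symm⟩
    exact ⟨sq.lift, sq.fac_left, sq.fac_right,
      fun c t ht ↦ (ReedyCategory.not_strict_terminal t ht).elim⟩
  -- An invariant predicate is a matching family of truth values for the constant diagram on `A`. A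
  -- lift is one truth value restricting to every `R t`.
  obtain ⟨k, -, -, hk⟩ := (Reedy.mem_fibrations_iff _).1
    ((h.isRightQuillen (Type w)).map_fibration _ hφ) i hi a
    (show PEmpty.{w + 1} ⟶ ULift.{w} Prop from ↾ PEmpty.elim) (𝟙 _)
    (fun c t _ ↦ ↾ fun _ ↦ ⟨R t⟩) rfl (fun c t _ ↦ by ext x; exact x.elim) (fun c t _ ↦ rfl)
    (fun c d t r ht ht' hr ↦ by
      ext
      exact congrArg ULift.up (propext (hR t r ht hr ht')))
  have hk' {d : A} (t : a ⟶ d) (ht : ReedyCategory.inverse.strict t) :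
      (k : PUnit ⟶ ULift.{w} Prop) ⟨⟩ = ⟨R t⟩ :=
    ConcreteCategory.congr_hom (C := Type w) (hk t ht) ⟨⟩
  exact iff_of_eq (congrArg ULift.down ((hk' s hs).symm.trans (hk' s' hs')))

/-- The latching categories of a right fibrant Reedy category are empty or connected. -/
lemma IsRightFibrant.iff (h : IsRightFibrant.{w + 1, w} A) {a : A}
    (R : ∀ ⦃c : A⦄ (_ : c ⟶ a), Prop)
    (hR : ∀ ⦃c c' : A⦄ (s : c ⟶ a) (r : c' ⟶ c), ReedyCategory.direct.strict s →
      ReedyCategory.direct r → ReedyCategory.direct.strict (r ≫ s) → (R s ↔ R (r ≫ s)))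
    ⦃c c' : A⦄ (s : c ⟶ a) (s' : c' ⟶ a) (hs : ReedyCategory.direct.strict s)
    (hs' : ReedyCategory.direct.strict s') : R s ↔ R s' := by
  let _ : ModelCategory (Type w) := monoEpiModelCategory
  let p : ULift.{w} Prop ⟶ PUnit.{w + 1} := ↾ fun _ ↦ ⟨⟩
  let φ : PEmpty.{w + 1} ⟶ PUnit.{w + 1} := ↾ PEmpty.elim
  have : Mono φ := (mono_iff_injective _).2 (fun x ↦ x.elim)
  have hp : trivialFibrations (Type w) p :=
    ⟨(epi_iff_surjective _).2 fun _ ↦ ⟨⟨True⟩, rfl⟩, trivial⟩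
  have hφ : Reedy.cofibrations (Discrete PUnit.{w + 1}) (Type w)
      ((Functor.const (Discrete PUnit.{w + 1})).map φ) := by
    rw [Reedy.mem_cofibrations_iff]
    intro K L j hj x q s l hpq _ _ _
    have : Epi j := hj.1
    have := Types.hasLiftingProperty_of_mono_of_epi φ j
    have sq : CommSq s.unop φ j q.unop := ⟨congrArg Quiver.Hom.unop hpq⟩
    exact ⟨sq.lift.op, congrArg Quiver.Hom.op sq.fac_right, congrArg Quiver.Hom.op sq.fac_left,
      fun c t ht ↦ (ReedyCategory.not_strict_terminal t.unop ((strict_op_iff _ _).1 ht)).elim⟩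
  -- Dually, the restricted cofibration has constant source the empty set and constant target the
  -- point; lifting it against the map from truth values to the point yields the common value of
  -- `R`.
  obtain ⟨k, -, -, hk⟩ := (Reedy.mem_cofibrations_iff _).1
    ((h.isLeftQuillen (Type w)).map_cofibration _ hφ) p hp a (𝟙 _)
    (show PEmpty.{w + 1} ⟶ ULift.{w} Prop from ↾ PEmpty.elim).op
    (fun c t _ ↦ (show PUnit.{w + 1} ⟶ ULift.{w} Prop from ↾ fun _ ↦ ⟨R t.unop⟩).op)
    (Quiver.Hom.unop_inj (by ext)) (fun c t _ ↦ rfl)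
    (fun c t _ ↦ Quiver.Hom.unop_inj (by ext x; exact x.elim))
    (fun c d t r ht ht' hr ↦ Quiver.Hom.unop_inj (by
      ext
      exact hR t.unop r.unop ((strict_op_iff _ _).1 ht) hr ((strict_op_iff _ _).1 ht')))
  have hk' {d : A} (t : d ⟶ a) (ht : ReedyCategory.direct.strict t) :
      (k.unop : PUnit ⟶ ULift.{w} Prop) ⟨⟩ = ⟨R t⟩ :=
    ConcreteCategory.congr_hom (C := Type w)
      (congrArg Quiver.Hom.unop (hk t.op ((strict_op_iff _ _).2 ht))) ⟨⟩
  exact iff_of_eq (congrArg ULift.down ((hk' s hs).symm.trans (hk' s' hs')))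

end

/-! ### Connected factorizations for slice categories. -/

section

open MorphismProperty

variable {A : Type w} [SmallCategory A] {C : Type u} [Category.{w} C]
  {F : A ⥤ C}

lemma CategoryTheory.CostructuredArrow.identities_left_iff {γ : C}
    {x y : CostructuredArrow F γ} (f : x ⟶ y) :
    identities A f.left ↔ identities (CostructuredArrow F γ) f := by
  refine ⟨fun hf ↦ ?_, fun hf ↦ by cases hf; constructor⟩
  obtain ⟨a, ⟨⟨⟩⟩, k⟩ := x
  obtain ⟨b, ⟨⟨⟩⟩, l⟩ := y
  have hw := CostructuredArrow.w f
  generalize hm : f.left = m at hf hw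
  dsimp at m hm hw hf
  cases hf
  obtain rfl : l = k := by simpa using hw
  obtain rfl : f = 𝟙 _ := CostructuredArrow.hom_ext _ _ hm
  constructor

lemma CategoryTheory.StructuredArrow.identities_right_iff {γ : C}
    {x y : StructuredArrow γ F} (f : x ⟶ y) :
    identities A f.right ↔ identities (StructuredArrow γ F) f := by
  refine ⟨fun hf ↦ ?_, fun hf ↦ by cases hf; constructor⟩
  obtain ⟨⟨⟨⟩⟩, a, k⟩ := x
  obtain ⟨⟨⟨⟩⟩, b, l⟩ := y
  have hw := StructuredArrow.w f
  generalize hm : f.right = m at hf hw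
  change a ⟶ b at m
  change f.right = m at hm
  replace hw : k ≫ F.map m = l := hw
  cases hf
  obtain rfl : k = l := by simpa using hw
  obtain rfl : f = 𝟙 _ := StructuredArrow.hom_ext _ _ hm
  constructor

variable [ReedyCategory A]

lemma ReedyCategory.strict_inverse_left_iff {γ : C} {x y : CostructuredArrow F γ} (f : x ⟶ y) :
    inverse.strict f.left ↔ inverse.strict f :=
  and_congr Iff.rfl (not_congr (CostructuredArrow.identities_left_iff f))

lemma ReedyCategory.strict_direct_right_iff {γ : C} {x y : StructuredArrow γ F} (f : x ⟶ y) :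
    direct.strict f.right ↔ direct.strict f :=
  and_congr Iff.rfl (not_congr (StructuredArrow.identities_right_iff f))

/-- A factorization of `σ` through `F.map s` is a morphism out of `CostructuredArrow.mk σ` in the
slice, so this is connectedness of the matching category there. -/
lemma factorizationsConnected_inverse
    (h : ∀ γ : C, IsLeftFibrant.{w + 1, w} (CostructuredArrow F γ)) ⦃a : A⦄ ⦃γ : C⦄
    (σ : F.obj a ⟶ γ) : FactorizationsConnected F ReedyCategory.inverse ⊤ σ := by
  intro R hR c c' s s' t t' hs hs' _ _ hst hst'
  let m : CostructuredArrow.mk σ ⟶ CostructuredArrow.mk t := CostructuredArrow.homMk s hst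
  let m' : CostructuredArrow.mk σ ⟶ CostructuredArrow.mk t' := CostructuredArrow.homMk s' hst'
  refine (h γ).iff (a := CostructuredArrow.mk σ) (fun d s ↦ R s.left d.hom) ?_ m m'
    ((ReedyCategory.strict_inverse_left_iff m).1 hs)
    ((ReedyCategory.strict_inverse_left_iff m').1 hs')
  intro d d' s r hs hr hsr
  exact hR s.left r.left d.hom d'.hom ((ReedyCategory.strict_inverse_left_iff _).2 hs) hr
    ((ReedyCategory.strict_inverse_left_iff _).2 hsr) trivial trivial (CostructuredArrow.w s)
    (CostructuredArrow.w r)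

lemma factorizationsConnected_direct_op
    (h : ∀ γ : C, IsRightFibrant.{w + 1, w} (StructuredArrow γ F)) ⦃a : Aᵒᵖ⦄ ⦃γ : Cᵒᵖ⦄
    (σ : F.op.obj a ⟶ γ) :
    FactorizationsConnected F.op (ReedyCategory.direct (A := A)).op ⊤ σ := by
  intro R hR c c' s s' t t' hs hs' _ _ hst hst'
  refine (h γ.unop).iff (a := StructuredArrow.mk σ.unop) (fun d s ↦ R s.right.op d.hom.op) ?_
    (StructuredArrow.homMk s.unop (congrArg Quiver.Hom.unop hst) :
      StructuredArrow.mk t.unop ⟶ StructuredArrow.mk σ.unop)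
    (StructuredArrow.homMk s'.unop (congrArg Quiver.Hom.unop hst') :
      StructuredArrow.mk t'.unop ⟶ StructuredArrow.mk σ.unop)
    ((ReedyCategory.strict_direct_right_iff _).1 ((strict_op_iff _ _).1 hs))
    ((ReedyCategory.strict_direct_right_iff _).1 ((strict_op_iff _ _).1 hs'))
  intro d d' s r hs hr hsr
  exact hR s.right.op r.right.op d.hom.op d'.hom.op
    ((strict_op_iff _ _).2 ((ReedyCategory.strict_direct_right_iff _).2 hs)) hr
    ((strict_op_iff _ _).2 ((ReedyCategory.strict_direct_right_iff _).2 hsr)) trivial trivial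
    (congrArg Quiver.Hom.op (StructuredArrow.w s)) (congrArg Quiver.Hom.op (StructuredArrow.w r))

/-- A morphism in a slice is a morphism of `A` with a compatibility condition. Unpacking a
factorization this way gives exactly the triple of `iff_of_factorizationsConnected`. -/
lemma factorizationsConnected_costructuredArrow_map [HasBinaryProducts C] [F.Full] [F.Faithful]
    (h : ∀ γ : C, IsLeftFibrant.{w + 1, w} (CostructuredArrow F γ)) {γ γ' : C} (g : γ ⟶ γ')
    ⦃x : CostructuredArrow F γ⦄ ⦃y : CostructuredArrow F γ'⦄
    (σ : (CostructuredArrow.map g).obj x ⟶ y) (hσ : ReedyCategory.inverse σ) :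
    FactorizationsConnected (CostructuredArrow.map g) ReedyCategory.inverse
      ReedyCategory.inverse σ := by
  intro R hR c c' s s' t t' hs hs' ht ht' hst hst'
  obtain ⟨α, _, _, _, _, ⟨ρ⟩⟩ := ReedyCategory.exists_reedyStructure (A := A)
  refine iff_of_factorizationsConnected ρ.wellFounded_strictlyBelow (fun _ _ _ ↦ ρ.of_comp₁)
    (factorizationsConnected_inverse h) g x.hom y.hom σ.left hσ (CostructuredArrow.w σ)
    (fun d s v t h₁ h₂ ↦ R (c := CostructuredArrow.mk v) (CostructuredArrow.homMk s h₁)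
      (CostructuredArrow.homMk t h₂)) ?_ s.left s'.left c.hom c'.hom t.left t'.left
    ((ReedyCategory.strict_inverse_left_iff _).2 hs)
    ((ReedyCategory.strict_inverse_left_iff _).2 hs')
    (congrArg CommaMorphism.left hst) (congrArg CommaMorphism.left hst')
    (CostructuredArrow.w s) (CostructuredArrow.w t) (CostructuredArrow.w s')
    (CostructuredArrow.w t')
  intro d d' s r v v' t t' hs hr hsr ht ht' hst hrt hrv h₁ h₂ h₃ h₄
  exact hR (c := CostructuredArrow.mk v) (c' := CostructuredArrow.mk v')
    (CostructuredArrow.homMk s h₁) (CostructuredArrow.homMk r hrv)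
    (CostructuredArrow.homMk t h₂) (CostructuredArrow.homMk t' h₄)
    ((ReedyCategory.strict_inverse_left_iff _).1 hs) hr
    ((ReedyCategory.strict_inverse_left_iff _).1 hsr) ht ht'
    (CostructuredArrow.hom_ext _ _ hst) (CostructuredArrow.hom_ext _ _ hrt)

lemma factorizationsConnected_structuredArrow_map_op [HasBinaryCoproducts C] [F.Full] [F.Faithful]
    (h : ∀ γ : C, IsRightFibrant.{w + 1, w} (StructuredArrow γ F)) {γ γ' : C} (g : γ ⟶ γ')
    ⦃x : (StructuredArrow γ' F)ᵒᵖ⦄ ⦃y : (StructuredArrow γ F)ᵒᵖ⦄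
    (σ : (StructuredArrow.map g).op.obj x ⟶ y)
    (hσ : (ReedyCategory.direct (A := StructuredArrow γ F)).op σ) :
    FactorizationsConnected (StructuredArrow.map g).op
      (ReedyCategory.direct (A := StructuredArrow γ' F)).op
      (ReedyCategory.direct (A := StructuredArrow γ F)).op σ := by
  intro R hR c c' s s' t t' hs hs' ht ht' hst hst'
  obtain ⟨α, _, _, _, _, ⟨ρ⟩⟩ := ReedyCategory.exists_reedyStructure (A := A)
  refine iff_of_factorizationsConnected (a := .op x.unop.right) (b := .op y.unop.right)
    ρ.op.wellFounded_strictlyBelow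
    (fun _ _ _ ↦ ρ.op.of_comp₁)
    (factorizationsConnected_direct_op h) g.op x.unop.hom.op y.unop.hom.op σ.unop.right.op hσ
    (congrArg Quiver.Hom.op (StructuredArrow.w σ.unop))
    (fun d s v t h₁ h₂ ↦ R (c := .op (StructuredArrow.mk v.unop))
      (StructuredArrow.homMk s.unop (congrArg Quiver.Hom.unop h₁) :
        StructuredArrow.mk v.unop ⟶ x.unop).op
      (StructuredArrow.homMk t.unop (congrArg Quiver.Hom.unop h₂) :
        y.unop ⟶ (StructuredArrow.map g).obj (StructuredArrow.mk v.unop)).op)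
    ?_ s.unop.right.op s'.unop.right.op c.unop.hom.op c'.unop.hom.op t.unop.right.op
    t'.unop.right.op
    ((strict_op_iff _ _).2 ((ReedyCategory.strict_direct_right_iff _).2 ((strict_op_iff _ _).1 hs)))
    ((strict_op_iff _ _).2
      ((ReedyCategory.strict_direct_right_iff _).2 ((strict_op_iff _ _).1 hs')))
    (congrArg (fun k ↦ k.unop.right.op) hst) (congrArg (fun k ↦ k.unop.right.op) hst')
    (congrArg Quiver.Hom.op (StructuredArrow.w s.unop))
    (congrArg Quiver.Hom.op (StructuredArrow.w t.unop))
    (congrArg Quiver.Hom.op (StructuredArrow.w s'.unop))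
    (congrArg Quiver.Hom.op (StructuredArrow.w t'.unop))
  intro d d' s r v v' t t' hs hr hsr ht ht' hst hrt hrv h₁ h₂ h₃ h₄
  exact hR (c := .op (StructuredArrow.mk v.unop)) (c' := .op (StructuredArrow.mk v'.unop))
    (StructuredArrow.homMk s.unop (congrArg Quiver.Hom.unop h₁) :
      StructuredArrow.mk v.unop ⟶ x.unop).op
    (StructuredArrow.homMk r.unop (congrArg Quiver.Hom.unop hrv) :
      StructuredArrow.mk v'.unop ⟶ StructuredArrow.mk v.unop).op
    (StructuredArrow.homMk t.unop (congrArg Quiver.Hom.unop h₂) :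
      y.unop ⟶ (StructuredArrow.map g).obj (StructuredArrow.mk v.unop)).op
    (StructuredArrow.homMk t'.unop (congrArg Quiver.Hom.unop h₄) :
      y.unop ⟶ (StructuredArrow.map g).obj (StructuredArrow.mk v'.unop)).op
    ((strict_op_iff _ _).2 ((ReedyCategory.strict_direct_right_iff _).1 ((strict_op_iff _ _).1 hs)))
    hr
    ((strict_op_iff _ _).2
      ((ReedyCategory.strict_direct_right_iff _).1 ((strict_op_iff _ _).1 hsr))) ht ht'
    (Quiver.Hom.unop_inj (StructuredArrow.hom_ext _ _ (congrArg Quiver.Hom.unop hst)))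
    (Quiver.Hom.unop_inj (StructuredArrow.hom_ext _ _ (congrArg Quiver.Hom.unop hrt)))

end

/-! ### From connected factorizations to Quillen functors. -/

section

open MorphismProperty

variable {A B : Type w} [SmallCategory A] [ReedyCategory A] [SmallCategory B] [ReedyCategory B]
  {f : A ⥤ B}

/-- A morphism of Reedy categories is a left fibration if the categories of factorizations of
inverse morphisms `f.obj a ⟶ b` are empty or connected. -/
lemma IsLeftFibration.of_factorizationsConnected (hf : IsReedyMorphism f)
    (conn : ∀ ⦃a : A⦄ ⦃b : B⦄ (σ : f.obj a ⟶ b), ReedyCategory.inverse σ →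
      FactorizationsConnected f ReedyCategory.inverse ReedyCategory.inverse σ) :
    IsLeftFibration.{u', w} f where
  isReedyMorphism := hf
  isRightQuillen M _ _ _ _ := by
    obtain ⟨α, _, _, _, _, ⟨ρ⟩⟩ := ReedyCategory.exists_reedyStructure (A := B)
    have key ⦃X Y : B ⥤ M⦄ (p : X ⟶ Y) (hp : Reedy.fibrations B M p) :
        Reedy.fibrations A M (((Functor.whiskeringLeft A B M).obj f).map p) := by
      rw [Reedy.mem_fibrations_iff] at hp ⊢
      exact fun K L i hi a ↦
        HasMatchingLift.whiskerLeft hf.map_inverse ρ.wellFounded_strictlyBelow conn (hp i hi) a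
    -- The left adjoint is left Kan extension along `f`. Objectwise weak equivalences restrict along
    -- `f` trivially.
    exact ⟨(f.lanAdjunction M).isRightAdjoint, key, fun X Y p hp hp' ↦ ⟨key p hp, fun a ↦ hp' _⟩⟩

/-- A morphism of Reedy categories is a right fibration if the categories of factorizations of
direct morphisms `b ⟶ f.obj a` are empty or connected. -/
lemma IsRightFibration.of_factorizationsConnected (hf : IsReedyMorphism f)
    (conn : ∀ ⦃a : Aᵒᵖ⦄ ⦃b : Bᵒᵖ⦄ (σ : f.op.obj a ⟶ b),
      (ReedyCategory.direct (A := B)).op σ → FactorizationsConnected f.op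
        (ReedyCategory.direct (A := A)).op (ReedyCategory.direct (A := B)).op σ) :
    IsRightFibration.{u', w} f where
  isReedyMorphism := hf
  isLeftQuillen M _ _ _ _ := by
    obtain ⟨α, _, _, _, _, ⟨ρ⟩⟩ := ReedyCategory.exists_reedyStructure (A := B)
    have key ⦃X Y : B ⥤ M⦄ (i : X ⟶ Y) (hi : Reedy.cofibrations B M i) :
        Reedy.cofibrations A M (((Functor.whiskeringLeft A B M).obj f).map i) := by
      rw [Reedy.mem_cofibrations_iff] at hi ⊢
      exact fun K L p hp a ↦
        HasMatchingLift.whiskerLeft (fun _ _ s hs ↦ hf.map_direct s.unop hs)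
          ρ.op.wellFounded_strictlyBelow conn (fun b ↦ hi p hp b.unop) (.op a)
    exact ⟨(f.ranAdjunction M).isLeftAdjoint, key, fun X Y i hi hi' ↦ ⟨key i hi, fun a ↦ hi' _⟩⟩

end

theorem mainTheorem3 {A : Type w} [SmallCategory A] [ReedyCategory A]
    {C : Type u} [Category.{w} C] (F : A ⥤ C) [F.Full] [F.Faithful] :
    (HasFiniteProducts C →
      (∀ γ : C, IsLeftFibrant.{w + 1, w} (CostructuredArrow F γ)) →
      ∀ (γ γ' : C) (g : γ ⟶ γ'),
        IsLeftFibration.{u', w} (CostructuredArrow.map g :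
          CostructuredArrow F γ ⥤ CostructuredArrow F γ')) ∧
    (HasFiniteCoproducts C →
      (∀ γ : C, IsRightFibrant.{w + 1, w} (StructuredArrow γ F)) →
      ∀ (γ γ' : C) (g : γ ⟶ γ'),
        IsRightFibration.{u', w} (StructuredArrow.map g :
          StructuredArrow γ' F ⥤ StructuredArrow γ F)) :=
  -- Changing the base of a slice leaves underlying morphisms in `A` untouched, so inverse and
  -- direct morphisms are preserved by definition.
  ⟨fun _ h _ _ g ↦ .of_factorizationsConnected ⟨fun _ _ _ h ↦ h, fun _ _ _ h ↦ h⟩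
      (factorizationsConnected_costructuredArrow_map h g),
    fun _ h _ _ g ↦ .of_factorizationsConnected ⟨fun _ _ _ h ↦ h, fun _ _ _ h ↦ h⟩
      (factorizationsConnected_structuredArrow_map_op h g)⟩
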